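/- Let $A$ be a commutative complex Banach algebra (not necessarily unital), with spectral radius $r_A(x)=\lim_n\|x^n\|^{1/n}$. An ideal of $A$ is a linear subspace $I$ with $AI\subseteq I$; a closed ideal is regarded as a commutative Banach algebra with the restricted norm. A commutative Banach algebra $C$ has the spectral extension property (SEP) if for every commutative Banach algebra $B$ and every injective (not necessarily continuous) algebra homomorphism $\theta:C\to B$ one has $r_B(\theta(x))=r_C(x)$ for all $x\in C$. Theorem. Let $A$ be a commutative Banach algebra. Then $A$ has a largest (with respect to inclusion) closed ideal $J$ with SEP, and $J$ is the closed ideal of $A$ generated by the union of all closed ideals of $A$ having SEP. If moreover $A$ is semisimple, i.e. for every $x\neq 0$ in $A$ there is a nonzero multiplicative linear functional $\varphi$ on $A$ with $\varphi(x)\neq 0$, then: (i) $J$ has the unique uniform norm property: there is exactly one submultiplicative (not necessarily complete) norm $|\cdot|$ on $J$ with $|x^2|=|x|^2$ for all $x\in J$; (ii) $J$ has Meyer's $(P)$-property: every nonzero closed ideal of $J$ contains a nonzero element $x$ with $r_p(x)>0$, where the permanent radius $r_p(x)$ is the infimum, over all submultiplicative norms $|\cdot|$ on $J$, of the spectral radius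 $\lim_n|x^n|^{1/n}$ of $x$ in the completion of $(J,|\cdot|)$. -/

import Mathlib

open Filter Topology

namespace SpectralExt

universe u

/-- The power `x ^ (n + 1)`, in an algebra that need not have an identity. -/
def powSucc {A : Type*} [Mul A] (x : A) : ℕ → A
  | 0 => x
  | n + 1 => powSucc x n * x

section Definitions

variable {A : Type*} [NonUnitalNormedCommRing A] [NormedSpace ℂ A]

/-- `p` is a submultiplicative algebra norm on the complex algebra `A`, not necessarily complete
and not necessarily related to the given norm of `A`. -/
def IsAlgNorm (p : Seminorm ℂ A) : Prop :=
  (∀ x, p x = 0 → x = 0) ∧ ∀ x y, p (x * y) ≤ p x * p y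

/-- `p` is a uniform norm: a submultiplicative norm with the square property. -/
def IsUniformNorm (p : Seminorm ℂ A) : Prop :=
  IsAlgNorm p ∧ ∀ x, p (x * x) = p x ^ 2

/-- The radius `lim_n p (x ^ n) ^ (1 / n)`. If `p` is a submultiplicative norm, this is the
spectral radius of `x` in the completion of `A` with respect to `p`, because the norm of the
completion restricts to `p` on `A`. The limit always exists, see `tendsto_radius`. -/
noncomputable def radius (p : Seminorm ℂ A) (x : A) : ℝ :=
  limUnder atTop fun n : ℕ => p (powSucc x n) ^ (1 / ((n : ℝ) + 1))

variable (A) in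
/-- The spectral radius `r(x) = lim_n ‖x ^ n‖ ^ (1 / n)` with respect to the given norm. -/
noncomputable def specRadius (x : A) : ℝ :=
  radius (normSeminorm ℂ A) x

variable (A) in
/-- The permanent radius: the infimum of the spectral radii of `x` in the completions of `A` with
respect to all submultiplicative norms. -/
noncomputable def permanentRadius (x : A) : ℝ :=
  sInf {t : ℝ | ∃ p : Seminorm ℂ A, IsAlgNorm p ∧ t = radius p x}

variable (A) in
/-- Semisimplicity: the characters (nonzero multiplicative linear functionals) of `A` have
common kernel `{0}`. -/
def IsSemisimpleAlg : Prop :=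
  ∀ x : A, (∀ φ : WeakDual.characterSpace ℂ A, φ x = 0) → x = 0

variable (A) in
/-- The unique uniform norm property. -/
def HasUUNP : Prop :=
  ∃! p : Seminorm ℂ A, IsUniformNorm p

/-- A subalgebra of a normed algebra carries the restricted norm. -/
instance subalgebraNormedSpace (I : NonUnitalSubalgebra ℂ A) : NormedSpace ℂ I where
  norm_smul_le c x := norm_smul_le c (x : A)

/-- A closed ideal of `A`: a norm-closed linear subspace `I` with `A * I ⊆ I`. -/
def IsClosedIdeal (I : NonUnitalSubalgebra ℂ A) : Prop :=
  IsClosed (I : Set A) ∧ ∀ a : A, ∀ x ∈ I, a * x ∈ I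

/-- The closed ideal generated by a set `S`: the intersection of all closed ideals that
contain `S`. -/
def closedIdealSpan [IsScalarTower ℂ A A] [SMulCommClass ℂ A A] (S : Set A) :
    NonUnitalSubalgebra ℂ A :=
  sInf {I | IsClosedIdeal I ∧ S ⊆ I}

variable (A) in
/-- The (P)-property: every nonzero closed ideal contains a nonzero element with strictly
positive permanent radius. -/
def HasPropertyP : Prop :=
  ∀ I : NonUnitalSubalgebra ℂ A, IsClosedIdeal I → (∃ y ∈ I, y ≠ 0) →
    ∃ x ∈ I, x ≠ 0 ∧ 0 < permanentRadius A x

end Definitions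

/-- The spectral extension property: whenever `A` is embedded algebraically (by an injective,
not necessarily continuous, algebra homomorphism) in a commutative Banach algebra `B`, the
spectral radius in `B` of each element of `A` is its spectral radius in `A`. -/
def HasSEP (A : Type u) [NonUnitalNormedCommRing A] [NormedSpace ℂ A] : Prop :=
  ∀ (B : Type u) [NonUnitalNormedCommRing B] [NormedSpace ℂ B] [IsScalarTower ℂ B B]
    [SMulCommClass ℂ B B] [CompleteSpace B] (θ : A →ₙₐ[ℂ] B),
    Function.Injective θ → ∀ x : A, specRadius B (θ x) = specRadius A x

section Limit

variable {A : Type*} [NonUnitalNormedCommRing A] [NormedSpace ℂ A] [IsScalarTower ℂ A A]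
  [SMulCommClass ℂ A A]

theorem inr_pow_succ (x : A) (n : ℕ) :
    (Unitization.inr x : Unitization ℂ A) ^ (n + 1) = Unitization.inr (powSucc x n) := by
  induction n with
  | zero => simp [powSucc]
  | succ n ih => rw [pow_succ, ih, powSucc, Unitization.inr_mul]

/-- The extension of a submultiplicative seminorm to the unitization. -/
noncomputable def unitizationSeminorm (p : Seminorm ℂ A) (hp : ∀ x y, p (x * y) ≤ p x * p y) :
    RingSeminorm (Unitization ℂ A) where
  toFun z := ‖z.fst‖ + p z.snd
  map_zero' := by simp
  add_le' z w := by
    have h1 := norm_add_le z.fst w.fst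
    have h2 := map_add_le_add p z.snd w.snd
    simp only [Unitization.fst_add, Unitization.snd_add]
    linarith
  neg' z := by simp
  mul_le' z w := by
    have h1 := map_add_le_add p (z.fst • w.snd + w.fst • z.snd) (z.snd * w.snd)
    have h2 := map_add_le_add p (z.fst • w.snd) (w.fst • z.snd)
    have h3 := hp z.snd w.snd
    simp only [map_smul_eq_mul] at h2
    simp only [Unitization.fst_mul, Unitization.snd_mul, norm_mul]
    linarith

/-- The limit that defines the radius exists. -/
theorem tendsto_radius (p : Seminorm ℂ A) (hp : ∀ x y, p (x * y) ≤ p x * p y) (x : A) :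
    Tendsto (fun n : ℕ => p (powSucc x n) ^ (1 / ((n : ℝ) + 1))) atTop (𝓝 (radius p x)) := by
  have h1 : unitizationSeminorm p hp 1 ≤ 1 := by
    change ‖(1 : Unitization ℂ A).fst‖ + p (1 : Unitization ℂ A).snd ≤ 1
    simp
  have h := (tendsto_smoothingFun_of_map_one_le_one (unitizationSeminorm p hp) h1
    (Unitization.inr x)).comp (tendsto_add_atTop_nat 1)
  have h' : Tendsto (fun n : ℕ => p (powSucc x n) ^ (1 / ((n : ℝ) + 1))) atTop
      (𝓝 (smoothingFun (unitizationSeminorm p hp) (Unitization.inr x))) := by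
    refine h.congr fun n => ?_
    have e : unitizationSeminorm p hp ((Unitization.inr x : Unitization ℂ A) ^ (n + 1)) =
        p (powSucc x n) := by
      rw [inr_pow_succ]
      change ‖(Unitization.inr (powSucc x n) : Unitization ℂ A).fst‖ + p (powSucc x n) = _
      simp
    simp only [Function.comp_apply, smoothingSeminormSeq, e]
    push_cast
    rfl
  exact tendsto_nhds_limUnder ⟨_, h'⟩

end Limit

end SpectralExt

/-! By Gelfand theory, `r(x)` is the maximum of `|f x|` over multiplicative linear functionals `f`,
zero included. Let `J` be generated by the SEP ideals, `θ : J → B` injective, and suppose `r(θ x) <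
r(x)`. Pick `f` on `J` with `|f x| = r(x)`. Since `ker f` is a closed ideal of `A` not containing
`J`, some SEP ideal `I` has `a ∈ I` with `f a ≠ 0`. As `a xⁿ ∈ I`, SEP of `I` gives `|f a| r(x)ⁿ ≤
r(θ(a xⁿ)) ≤ r(θ a) r(θ x)ⁿ`, which forces `f a = 0` as `n → ∞`, a contradiction
(`hasSEP_closedIdealSpan`).

If `A` is semisimple, `r` is a uniform norm on `J`. SEP makes every submultiplicative norm on `J`
have radius `r` (`HasSEP.radius_eq`), and a uniform norm equals its radius; hence uniqueness, and
the permanent radius is `r > 0` off zero. -/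

namespace SpectralExt

/-! ### Powers without an identity -/

section PowSucc

variable {A : Type*} [NonUnitalNormedCommRing A]

theorem powSucc_add_add_one (x : A) (m n : ℕ) :
    powSucc x (m + n + 1) = powSucc x m * powSucc x n := by
  induction n with
  | zero => rfl
  | succ n ih =>
    rw [show m + (n + 1) + 1 = (m + n + 1) + 1 by omega, powSucc, ih, powSucc, mul_assoc]

theorem map_powSucc {B F : Type*} [Mul B] [FunLike F A B] [MulHomClass F A B] (f : F) (x : A)
    (n : ℕ) : f (powSucc x n) = powSucc (f x) n := by
  induction n with
  | zero => rfl
  | succ n ih => rw [powSucc, map_mul, ih, powSucc]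

theorem powSucc_eq_pow {M : Type*} [Monoid M] (x : M) (n : ℕ) : powSucc x n = x ^ (n + 1) := by
  induction n with
  | zero => simp [powSucc]
  | succ n ih => rw [powSucc, ih, ← pow_succ]

end PowSucc

/-! ### Radii of seminorms -/

section Radius

variable {A : Type*} [NonUnitalNormedCommRing A] [NormedSpace ℂ A]

/-- Multiplicative maps that preserve seminorms preserve radii. -/
theorem radius_map_eq {B F : Type*} [NonUnitalNormedCommRing B] [NormedSpace ℂ B] [FunLike F A B]
    [MulHomClass F A B] (p : Seminorm ℂ A) (q : Seminorm ℂ B) (f : F)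
    (h : ∀ x, q (f x) = p x) (x : A) : radius q (f x) = radius p x := by
  unfold radius
  congr 1
  funext n
  rw [← map_powSucc, h]

variable [IsScalarTower ℂ A A] [SMulCommClass ℂ A A]

theorem radius_nonneg {p : Seminorm ℂ A} (hp : ∀ x y, p (x * y) ≤ p x * p y) (x : A) :
    0 ≤ radius p x :=
  ge_of_tendsto' (tendsto_radius p hp x) fun _ => Real.rpow_nonneg (apply_nonneg p _) _

theorem tendsto_specRadius (x : A) :
    Tendsto (fun n : ℕ => ‖powSucc x n‖ ^ (1 / ((n : ℝ) + 1))) atTop (𝓝 (specRadius A x)) :=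
  tendsto_radius (normSeminorm ℂ A) norm_mul_le x

theorem specRadius_nonneg (x : A) : 0 ≤ specRadius A x :=
  radius_nonneg (p := normSeminorm ℂ A) norm_mul_le x

omit [NormedSpace ℂ A] [IsScalarTower ℂ A A] [SMulCommClass ℂ A A] in
theorem norm_powSucc_le (x : A) (n : ℕ) : ‖powSucc x n‖ ≤ ‖x‖ ^ (n + 1) := by
  induction n with
  | zero => simp [powSucc]
  | succ n ih =>
    calc ‖powSucc x n * x‖ ≤ ‖powSucc x n‖ * ‖x‖ := norm_mul_le _ _
      _ ≤ ‖x‖ ^ (n + 1) * ‖x‖ := by gcongr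
      _ = _ := (pow_succ _ _).symm

theorem specRadius_le_norm (x : A) : specRadius A x ≤ ‖x‖ := by
  refine le_of_tendsto' (tendsto_specRadius x) fun n => ?_
  have h : (‖x‖ ^ (n + 1)) ^ (1 / ((n : ℝ) + 1)) = ‖x‖ := by
    have := Real.pow_rpow_inv_natCast (norm_nonneg x) (Nat.succ_ne_zero n)
    simpa using this
  rw [← h]
  exact Real.rpow_le_rpow (norm_nonneg _) (norm_powSucc_le x n) (by positivity)

/-- A uniform norm is its own radius. -/
theorem IsUniformNorm.radius_eq {p : Seminorm ℂ A} (hp : IsUniformNorm p) (x : A) :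
    radius p x = p x := by
  -- `powSucc x n` is `x ^ (n + 1)`, so the index `2 ^ k - 1` gives the power `2 ^ k`, reached by
  -- repeated squaring.
  have key : ∀ k : ℕ, p (powSucc x (2 ^ k - 1)) = p x ^ (2 ^ k) := by
    intro k
    induction k with
    | zero => simp [powSucc]
    | succ k ih =>
      have h1 : 2 ^ (k + 1) - 1 = (2 ^ k - 1) + (2 ^ k - 1) + 1 := by
        have := Nat.one_le_two_pow (n := k)
        rw [pow_succ]
        omega
      rw [h1, powSucc_add_add_one, hp.2, ih, ← pow_mul, pow_succ]
  have hk : Tendsto (fun k : ℕ => 2 ^ k - 1) atTop atTop :=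
    (tendsto_sub_atTop_nat 1).comp (tendsto_pow_atTop_atTop_of_one_lt one_lt_two)
  have h := (tendsto_radius p hp.1.2 x).comp hk
  refine tendsto_nhds_unique (h.congr fun k => ?_) tendsto_const_nhds
  simp only [Function.comp_apply, key]
  have h2 : (((2 ^ k - 1 : ℕ) : ℝ) + 1) = ((2 ^ k : ℕ) : ℝ) := by
    rw [Nat.cast_sub Nat.one_le_two_pow]
    simp
  rw [h2, one_div]
  exact Real.pow_rpow_inv_natCast (apply_nonneg p x) (by positivity)

end Radius

/-! ### Gelfand theory through the unitization -/

section Unitization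

variable (A : Type*) [NonUnitalNormedCommRing A] [NormedSpace ℂ A]
  [IsScalarTower ℂ A A] [SMulCommClass ℂ A A]

/-- The unitization with the `L¹` norm. -/
abbrev L1Unitization : Type _ := WithLp 1 (Unitization ℂ A)

noncomputable instance : NormedCommRing (L1Unitization A) where
  __ := WithLp.instUnitizationNormedRing
  mul_comm x y := WithLp.ofLp_injective 1 (mul_comm (WithLp.ofLp x) (WithLp.ofLp y))

/-- The inclusion of an algebra in its unitization. -/
noncomputable def inrL1 : A →ₙₐ[ℂ] L1Unitization A :=
  ((WithLp.unitizationAlgEquiv (𝕜 := ℂ) (A := A) ℂ).symm.toAlgHom :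
    Unitization ℂ A →ₙₐ[ℂ] L1Unitization A).comp (Unitization.inrNonUnitalAlgHom ℂ A)

variable {A}

theorem norm_inrL1 (x : A) : ‖inrL1 A x‖ = ‖x‖ :=
  WithLp.unitization_norm_inr x

instance : Nontrivial (L1Unitization A) :=
  (WithLp.equiv 1 (Unitization ℂ A)).nontrivial

theorem spectralRadius_inrL1 [CompleteSpace A] (x : A) :
    spectralRadius ℂ (inrL1 A x) = ENNReal.ofReal (specRadius A x) := by
  have h1 := (spectrum.pow_norm_pow_one_div_tendsto_nhds_spectralRadius (inrL1 A x)).comp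
    (tendsto_add_atTop_nat 1)
  refine tendsto_nhds_unique h1 ((ENNReal.tendsto_ofReal (tendsto_specRadius x)).congr fun n => ?_)
  simp only [Function.comp_apply]
  rw [← powSucc_eq_pow, ← map_powSucc, norm_inrL1]
  push_cast
  rfl

/-- Homomorphisms of commutative Banach algebras do not increase the spectral radius. -/
theorem specRadius_map_le {B : Type*} [NonUnitalNormedCommRing B] [NormedSpace ℂ B]
    [IsScalarTower ℂ B B] [SMulCommClass ℂ B B] [CompleteSpace A] [CompleteSpace B]
    (θ : A →ₙₐ[ℂ] B) (x : A) : specRadius B (θ x) ≤ specRadius A x := by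
  -- No continuity of `θ` is needed: its unital extension `Θ` is an algebra homomorphism, and these
  -- shrink spectra.
  let Θ : L1Unitization A →ₐ[ℂ] L1Unitization B :=
    ((WithLp.unitizationAlgEquiv (𝕜 := ℂ) (A := B) ℂ).symm.toAlgHom.comp
      (Unitization.lift ((Unitization.inrNonUnitalAlgHom ℂ B).comp θ))).comp
      (WithLp.unitizationAlgEquiv (𝕜 := ℂ) (A := A) ℂ).toAlgHom
  have hΘ : Θ (inrL1 A x) = inrL1 B (θ x) := by
    refine WithLp.ofLp_injective 1 ?_
    change Unitization.lift ((Unitization.inrNonUnitalAlgHom ℂ B).comp θ)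
      (Unitization.inr x) = Unitization.inr (θ x)
    simp
  have h : spectralRadius ℂ (Θ (inrL1 A x)) ≤ spectralRadius ℂ (inrL1 A x) :=
    biSup_mono fun k hk => AlgHom.spectrum_apply_subset Θ _ hk
  rwa [hΘ, spectralRadius_inrL1, spectralRadius_inrL1,
    ENNReal.ofReal_le_ofReal_iff (specRadius_nonneg x)] at h

/-- Multiplicative linear functionals are bounded by the spectral radius. -/
theorem norm_apply_le_specRadius [CompleteSpace A] (f : A →ₙₐ[ℂ] ℂ) (x : A) :
    ‖f x‖ ≤ specRadius A x := by
  refine le_trans (le_of_eq ?_) (specRadius_map_le f x)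
  have h : IsUniformNorm (normSeminorm ℂ ℂ) :=
    ⟨⟨fun x hx => norm_eq_zero.1 hx, norm_mul_le⟩, fun x => by simp [sq]⟩
  exact (h.radius_eq (f x)).symm

/-- The spectral radius is attained by a multiplicative linear functional. -/
theorem exists_norm_apply_eq_specRadius [CompleteSpace A] (x : A) :
    ∃ f : A →ₙₐ[ℂ] ℂ, ‖f x‖ = specRadius A x := by
  -- A spectral value of largest modulus is the value of a character of the unitization; its
  -- restriction to `A` may vanish.
  obtain ⟨z, hz, hzr⟩ := spectrum.exists_nnnorm_eq_spectralRadius (inrL1 A x)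
  obtain ⟨φ, hφ⟩ := WeakDual.CharacterSpace.mem_spectrum_iff_exists.1 hz
  let g : L1Unitization A →ₙₐ[ℂ] ℂ := (WeakDual.CharacterSpace.toAlgHom φ : _ →ₐ[ℂ] ℂ)
  refine ⟨g.comp (inrL1 A), ?_⟩
  have hg : g.comp (inrL1 A) x = z := hφ
  rw [spectralRadius_inrL1, ← enorm_eq_nnnorm, ← ofReal_norm,
    ENNReal.ofReal_eq_ofReal_iff (norm_nonneg z) (specRadius_nonneg x)] at hzr
  rw [hg, hzr]

end Unitization

/-! ### The spectral radius as a uniform seminorm -/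

section RadiusNorm

variable {A : Type*} [NonUnitalNormedCommRing A] [NormedSpace ℂ A]
  [IsScalarTower ℂ A A] [SMulCommClass ℂ A A] [CompleteSpace A]

theorem specRadius_add_le (x y : A) : specRadius A (x + y) ≤ specRadius A x + specRadius A y := by
  obtain ⟨f, hf⟩ := exists_norm_apply_eq_specRadius (x + y)
  rw [← hf, map_add]
  exact (norm_add_le _ _).trans
    (add_le_add (norm_apply_le_specRadius f x) (norm_apply_le_specRadius f y))

theorem specRadius_mul_le (x y : A) : specRadius A (x * y) ≤ specRadius A x * specRadius A y := by
  obtain ⟨f, hf⟩ := exists_norm_apply_eq_specRadius (x * y)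
  rw [← hf, map_mul, norm_mul]
  exact mul_le_mul (norm_apply_le_specRadius f x) (norm_apply_le_specRadius f y)
    (norm_nonneg _) (specRadius_nonneg x)

theorem specRadius_mul_self (x : A) : specRadius A (x * x) = specRadius A x ^ 2 := by
  refine le_antisymm ((specRadius_mul_le x x).trans_eq (sq _).symm) ?_
  obtain ⟨f, hf⟩ := exists_norm_apply_eq_specRadius x
  rw [← hf, sq, ← norm_mul, ← map_mul]
  exact norm_apply_le_specRadius f _

theorem specRadius_powSucc_le (x : A) (n : ℕ) :
    specRadius A (powSucc x n) ≤ specRadius A x ^ (n + 1) := by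
  induction n with
  | zero => simp [powSucc]
  | succ n ih =>
    rw [powSucc, pow_succ]
    exact (specRadius_mul_le _ _).trans (mul_le_mul_of_nonneg_right ih (specRadius_nonneg x))

theorem specRadius_smul (c : ℂ) (x : A) : specRadius A (c • x) = ‖c‖ * specRadius A x := by
  apply le_antisymm
  · obtain ⟨f, hf⟩ := exists_norm_apply_eq_specRadius (c • x)
    rw [← hf, map_smul, norm_smul]
    exact mul_le_mul_of_nonneg_left (norm_apply_le_specRadius f x) (norm_nonneg c)
  · obtain ⟨f, hf⟩ := exists_norm_apply_eq_specRadius x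
    rw [← hf, ← norm_smul, ← map_smul]
    exact norm_apply_le_specRadius f _

variable (A) in
/-- The spectral radius as a seminorm. -/
noncomputable def specRadiusSeminorm : Seminorm ℂ A :=
  Seminorm.of (specRadius A) specRadius_add_le specRadius_smul

theorem isUniformNorm_specRadiusSeminorm (h : ∀ x : A, x ≠ 0 → 0 < specRadius A x) :
    IsUniformNorm (specRadiusSeminorm A) :=
  ⟨⟨fun x hx => by_contra fun hne => (h x hne).ne' hx, specRadius_mul_le⟩, specRadius_mul_self⟩

end RadiusNorm

/-! ### Change of norm -/

section Renormed

variable {A : Type*} [NonUnitalNormedCommRing A] [NormedSpace ℂ A]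

/-- The algebra `A` with the norm `p` in place of the given one. -/
def Renormed (p : Seminorm ℂ A) (_ : IsAlgNorm p) : Type _ := A

variable (p : Seminorm ℂ A) (hp : IsAlgNorm p)

instance : NonUnitalCommRing (Renormed p hp) := inferInstanceAs (NonUnitalCommRing A)

instance : Module ℂ (Renormed p hp) := inferInstanceAs (Module ℂ A)

instance [IsScalarTower ℂ A A] : IsScalarTower ℂ (Renormed p hp) (Renormed p hp) :=
  inferInstanceAs (IsScalarTower ℂ A A)

instance [SMulCommClass ℂ A A] : SMulCommClass ℂ (Renormed p hp) (Renormed p hp) :=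
  inferInstanceAs (SMulCommClass ℂ A A)

/-- The seminorm `p` as a norm on the additive group of `A`. -/
def Renormed.addGroupNorm : AddGroupNorm (Renormed p hp) where
  __ := p.toAddGroupSeminorm
  eq_zero_of_map_eq_zero' := hp.1

noncomputable instance : NonUnitalNormedCommRing (Renormed p hp) where
  __ := (Renormed.addGroupNorm p hp).toNormedAddCommGroup
  __ := (inferInstance : NonUnitalCommRing (Renormed p hp))
  norm_mul_le := hp.2

noncomputable instance : NormedSpace ℂ (Renormed p hp) where
  norm_smul_le c x := (map_smul_eq_mul p c x).le

/-- The identity map to the renormed algebra. -/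
def toRenormed : A →ₙₐ[ℂ] Renormed p hp := NonUnitalAlgHom.id ℂ A

end Renormed

/-! ### Consequences of the spectral extension property -/

section SEP

universe v

/-- The embedding of a normed algebra in its completion. -/
noncomputable def toCompletion (U : Type*) [NormedCommRing U] [NormedAlgebra ℂ U] :
    U →ₙₐ[ℂ] UniformSpace.Completion U where
  toFun := (↑)
  map_smul' c x := UniformSpace.Completion.coe_smul c x
  map_zero' := UniformSpace.Completion.coe_zero
  map_add' x y := UniformSpace.Completion.coe_add x y
  map_mul' x y := UniformSpace.Completion.coe_mul x y

/-- Every commutative normed algebra embeds isometrically in a commutative Banach algebra. -/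
theorem exists_isometric_embedding (C : Type v) [NonUnitalNormedCommRing C] [NormedSpace ℂ C]
    [IsScalarTower ℂ C C] [SMulCommClass ℂ C C] :
    ∃ (B : Type v) (_ : NormedCommRing B) (_ : NormedAlgebra ℂ B) (_ : CompleteSpace B)
      (j : C →ₙₐ[ℂ] B), ∀ y, ‖j y‖ = ‖y‖ :=
  ⟨UniformSpace.Completion (L1Unitization C), inferInstance, inferInstance, inferInstance,
    (toCompletion (L1Unitization C)).comp (inrL1 C), fun y =>
      (UniformSpace.Completion.norm_coe (inrL1 C y)).trans (norm_inrL1 y)⟩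

/-- In the definition of the spectral extension property, the larger algebra need not be
complete. -/
theorem HasSEP.specRadius_eq {A : Type v} [NonUnitalNormedCommRing A] [NormedSpace ℂ A]
    (hA : HasSEP A) {C : Type v} [NonUnitalNormedCommRing C] [NormedSpace ℂ C]
    [IsScalarTower ℂ C C] [SMulCommClass ℂ C C] (θ : A →ₙₐ[ℂ] C) (hθ : Function.Injective θ)
    (x : A) : specRadius C (θ x) = specRadius A x := by
  obtain ⟨B, _, _, _, j, hj⟩ := exists_isometric_embedding C
  have hinj : Function.Injective j := fun y z h => by
    rw [← sub_eq_zero, ← norm_eq_zero, ← hj, map_sub, h, sub_self, norm_zero]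
  rw [← hA B (j.comp θ) (hinj.comp hθ) x]
  exact (radius_map_eq (normSeminorm ℂ C) (normSeminorm ℂ B) j hj (θ x)).symm

/-- In an algebra with the spectral extension property all submultiplicative norms have the same
radius. -/
theorem HasSEP.radius_eq {A : Type v} [NonUnitalNormedCommRing A] [NormedSpace ℂ A]
    [IsScalarTower ℂ A A] [SMulCommClass ℂ A A] (hA : HasSEP A) {p : Seminorm ℂ A}
    (hp : IsAlgNorm p) (x : A) : radius p x = specRadius A x := by
  -- The identity into the renormed algebra may be discontinuous; SEP allows this.
  rw [← hA.specRadius_eq (toRenormed p hp) Function.injective_id x]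
  exact (radius_map_eq p (normSeminorm ℂ (Renormed p hp)) (toRenormed p hp) (fun _ => rfl) x).symm

variable {A : Type v} [NonUnitalNormedCommRing A] [NormedSpace ℂ A]
  [IsScalarTower ℂ A A] [SMulCommClass ℂ A A]

theorem HasSEP.hasUUNP [CompleteSpace A] (hA : HasSEP A)
    (h : ∀ x : A, x ≠ 0 → 0 < specRadius A x) : HasUUNP A :=
  ⟨specRadiusSeminorm A, isUniformNorm_specRadiusSeminorm h, fun _ hp =>
    Seminorm.ext fun x => (hp.radius_eq x).symm.trans (hA.radius_eq hp.1 x)⟩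

theorem HasSEP.permanentRadius_eq (hA : HasSEP A) (x : A) :
    permanentRadius A x = specRadius A x := by
  have h : {t : ℝ | ∃ p : Seminorm ℂ A, IsAlgNorm p ∧ t = radius p x} = {specRadius A x} := by
    refine Set.eq_singleton_iff_unique_mem.2 ⟨⟨normSeminorm ℂ A, ⟨?_, norm_mul_le⟩, rfl⟩, ?_⟩
    · exact fun x hx => norm_eq_zero.1 hx
    · rintro t ⟨p, hp, rfl⟩
      exact hA.radius_eq hp x
  rw [permanentRadius, h, csInf_singleton]

theorem HasSEP.hasPropertyP (hA : HasSEP A) (h : ∀ x : A, x ≠ 0 → 0 < specRadius A x) :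
    HasPropertyP A := by
  rintro I - ⟨y, hy, hy0⟩
  exact ⟨y, hy, hy0, (h y hy0).trans_eq (hA.permanentRadius_eq y).symm⟩

/-! ### Closed ideals and the largest SEP ideal -/

omit [IsScalarTower ℂ A A] [SMulCommClass ℂ A A] in
/-- The spectral radius of an element of a subalgebra does not depend on the subalgebra. -/
theorem specRadius_inclusion {I J : NonUnitalSubalgebra ℂ A} (h : I ≤ J) (x : I) :
    specRadius J (NonUnitalSubalgebra.inclusion h x) = specRadius I x :=
  radius_map_eq (normSeminorm ℂ I) (normSeminorm ℂ J) (NonUnitalSubalgebra.inclusion h)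
    (fun _ => rfl) x

theorem isClosedIdeal_closedIdealSpan (S : Set A) : IsClosedIdeal (closedIdealSpan S) := by
  refine ⟨?_, fun a x hx => ?_⟩
  · rw [closedIdealSpan, NonUnitalAlgebra.coe_sInf]
    exact isClosed_biInter fun I hI => hI.1.1
  · rw [closedIdealSpan, NonUnitalAlgebra.mem_sInf] at hx ⊢
    exact fun I hI => hI.1.2 a x (hx I hI)

theorem subset_closedIdealSpan (S : Set A) : S ⊆ closedIdealSpan S := by
  rw [closedIdealSpan, NonUnitalAlgebra.coe_sInf]
  exact Set.subset_iInter₂ fun I hI => hI.2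

theorem closedIdealSpan_le {S : Set A} {I : NonUnitalSubalgebra ℂ A} (hI : IsClosedIdeal I)
    (h : S ⊆ I) : closedIdealSpan S ≤ I :=
  sInf_le ⟨hI, h⟩

/-- The kernel of a multiplicative linear functional on an ideal, as a subalgebra of the whole
algebra. -/
def kerSubalgebra {J : NonUnitalSubalgebra ℂ A} (f : J →ₙₐ[ℂ] ℂ) : NonUnitalSubalgebra ℂ A where
  carrier := {a | ∃ h : a ∈ J, f ⟨a, h⟩ = 0}
  zero_mem' := ⟨J.zero_mem, map_zero f⟩
  add_mem' := by
    rintro a b ⟨ha, ha'⟩ ⟨hb, hb'⟩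
    refine ⟨J.add_mem ha hb, ?_⟩
    have := map_add f ⟨a, ha⟩ ⟨b, hb⟩
    rwa [ha', hb', add_zero] at this
  mul_mem' := by
    rintro a b ⟨ha, ha'⟩ ⟨hb, hb'⟩
    refine ⟨J.mul_mem ha hb, ?_⟩
    have := map_mul f ⟨a, ha⟩ ⟨b, hb⟩
    rwa [ha', zero_mul] at this
  smul_mem' := by
    rintro c a ⟨ha, ha'⟩
    refine ⟨J.smul_mem c ha, ?_⟩
    have := map_smul f c ⟨a, ha⟩
    rwa [ha', smul_zero] at this

variable [CompleteSpace A]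

omit [IsScalarTower ℂ A A] [SMulCommClass ℂ A A] in
theorem IsClosedIdeal.completeSpace {J : NonUnitalSubalgebra ℂ A} (hJ : IsClosedIdeal J) :
    CompleteSpace J :=
  hJ.1.completeSpace_coe

/-- The kernel absorbs all of `A`, not only `J`: if `f x = 0`, then `f (a x) f y = f x f (a y) = 0`,
and `f y ≠ 0`. -/
theorem isClosedIdeal_kerSubalgebra {J : NonUnitalSubalgebra ℂ A} (hJ : IsClosedIdeal J)
    (f : J →ₙₐ[ℂ] ℂ) {y : J} (hy : f y ≠ 0) : IsClosedIdeal (kerSubalgebra f) := by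
  have := hJ.completeSpace
  refine ⟨?_, ?_⟩
  · have hf : Continuous f := AddMonoidHomClass.continuous_of_bound f 1 fun x => by
      rw [one_mul]
      exact (norm_apply_le_specRadius f x).trans (specRadius_le_norm x)
    have hc : IsClosed {x : J | f x = 0} := isClosed_eq hf continuous_const
    have := hJ.1.isClosedEmbedding_subtypeVal.isClosedMap _ hc
    convert this using 1
    ext a
    change (∃ h : a ∈ J, f ⟨a, h⟩ = 0) ↔ _
    simp
  · rintro a x ⟨hx, hx'⟩
    refine ⟨hJ.2 a x hx, ?_⟩
    have h : (⟨a * x, hJ.2 a x hx⟩ : J) * y = ⟨x, hx⟩ * ⟨a * y, hJ.2 a y y.2⟩ :=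
      Subtype.ext (show a * x * (y : A) = x * (a * y) by rw [mul_comm a x, mul_assoc])
    have h2 := congrArg f h
    rw [map_mul, map_mul, hx', zero_mul] at h2
    exact (mul_eq_zero.1 h2).resolve_right hy

/-- A closed ideal generated by closed ideals with the spectral extension property has the
spectral extension property. -/
theorem hasSEP_closedIdealSpan (𝓘 : Set (NonUnitalSubalgebra ℂ A))
    (h𝓘 : ∀ I ∈ 𝓘, IsClosedIdeal I ∧ HasSEP I) :
    HasSEP (closedIdealSpan (⋃ I ∈ 𝓘, (I : Set A))) := by
  set J := closedIdealSpan (⋃ I ∈ 𝓘, (I : Set A)) with hJdef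
  have hJ : IsClosedIdeal J := isClosedIdeal_closedIdealSpan _
  have hle : ∀ I ∈ 𝓘, I ≤ J := fun I hI =>
    (Set.subset_biUnion_of_mem (u := fun I : NonUnitalSubalgebra ℂ A => (I : Set A)) hI).trans
      (subset_closedIdealSpan _)
  have := hJ.completeSpace
  intro B _ _ _ _ _ θ hθ x
  refine le_antisymm (specRadius_map_le θ x) (not_lt.1 fun hlt => ?_)
  obtain ⟨f, hf⟩ := exists_norm_apply_eq_specRadius x
  have hr : 0 < specRadius J x := (specRadius_nonneg _).trans_lt hlt
  have hfx : f x ≠ 0 := norm_pos_iff.1 (hf ▸ hr)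
  obtain ⟨I, hI, a, ha⟩ : ∃ I, ∃ hI : I ∈ 𝓘, ∃ a : I,
      f (NonUnitalSubalgebra.inclusion (hle I hI) a) ≠ 0 := by
    by_contra! hcon
    have hker : J ≤ kerSubalgebra f := closedIdealSpan_le (isClosedIdeal_kerSubalgebra hJ f hfx)
      (Set.iUnion₂_subset fun I hI a ha => ⟨hle I hI ha, hcon I hI ⟨a, ha⟩⟩)
    exact hfx (hker x.2).2
  set a' := NonUnitalSubalgebra.inclusion (hle I hI) a
  have hbound : ∀ n : ℕ,
      ‖f a'‖ ≤ specRadius B (θ a') * (specRadius B (θ x) / specRadius J x) ^ (n + 1) := by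
    intro n
    rw [div_pow, ← mul_div_assoc, le_div_iff₀ (pow_pos hr _)]
    -- The factor `a` moves the powers of `x` into `I`, where SEP is available.
    have hmem : (a : A) * (powSucc x n : J) ∈ I := by
      rw [mul_comm]
      exact (h𝓘 I hI).1.2 _ _ a.2
    let b : I := ⟨_, hmem⟩
    have hb : NonUnitalSubalgebra.inclusion (hle I hI) b = a' * powSucc x n := rfl
    calc ‖f a'‖ * specRadius J x ^ (n + 1) = ‖f (a' * powSucc x n)‖ := by
          rw [map_mul, map_powSucc, powSucc_eq_pow, norm_mul, norm_pow, hf]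
      _ ≤ specRadius J (a' * powSucc x n) := norm_apply_le_specRadius f _
      _ = specRadius I b := by rw [← hb, specRadius_inclusion]
      _ = specRadius B (θ (a' * powSucc x n)) := by
          rw [← (h𝓘 I hI).2 B (θ.comp (NonUnitalSubalgebra.inclusion (hle I hI)))
            (hθ.comp (NonUnitalSubalgebra.inclusion_injective (hle I hI))) b, ← hb]
          rfl
      _ ≤ specRadius B (θ a') * specRadius B (θ x) ^ (n + 1) := by
          rw [map_mul, map_powSucc]
          exact (specRadius_mul_le _ _).trans
            (mul_le_mul_of_nonneg_left (specRadius_powSucc_le _ n) (specRadius_nonneg _))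
  have hlim : Tendsto (fun n : ℕ =>
      specRadius B (θ a') * (specRadius B (θ x) / specRadius J x) ^ (n + 1)) atTop (𝓝 0) := by
    have h := (tendsto_pow_atTop_nhds_zero_of_lt_one
      (div_nonneg (specRadius_nonneg (θ x)) hr.le) ((div_lt_one hr).2 hlt)).comp
      (tendsto_add_atTop_nat 1)
    simpa using h.const_mul (specRadius B (θ a'))
  exact ha (norm_le_zero_iff.1 (ge_of_tendsto' hlim hbound))

/-- A character of `A` not vanishing at `x` restricts to `J` and bounds the radius from below. -/
theorem specRadius_pos_of_isSemisimpleAlg (hA : IsSemisimpleAlg A) {J : NonUnitalSubalgebra ℂ A}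
    (hJ : IsClosedIdeal J) (x : J) (hx : x ≠ 0) : 0 < specRadius J x := by
  have := hJ.completeSpace
  have h : ¬∀ φ : WeakDual.characterSpace ℂ A, φ (x : A) = 0 := fun h =>
    hx (Subtype.ext (hA x h))
  push Not at h
  obtain ⟨φ, hφ⟩ := h
  let f : J →ₙₐ[ℂ] ℂ := (WeakDual.CharacterSpace.toNonUnitalAlgHom φ).comp
    (NonUnitalSubalgebraClass.subtype J)
  exact (norm_pos_iff.2 hφ).trans_le (norm_apply_le_specRadius f x)

end SEP

end SpectralExt

theorem mainTheorem3 (A : Type*) [NonUnitalNormedCommRing A] [NormedSpace ℂ A]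
    [IsScalarTower ℂ A A] [SMulCommClass ℂ A A] [CompleteSpace A] :
    ∃ J : NonUnitalSubalgebra ℂ A,
      IsGreatest {I : NonUnitalSubalgebra ℂ A |
        SpectralExt.IsClosedIdeal I ∧ SpectralExt.HasSEP I} J ∧
      J = SpectralExt.closedIdealSpan
        (⋃ I ∈ {I : NonUnitalSubalgebra ℂ A |
          SpectralExt.IsClosedIdeal I ∧ SpectralExt.HasSEP I}, (I : Set A)) ∧
      (SpectralExt.IsSemisimpleAlg A →
        SpectralExt.HasUUNP J ∧ SpectralExt.HasPropertyP J) := by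
  have hJ := SpectralExt.isClosedIdeal_closedIdealSpan
    (⋃ I ∈ {I : NonUnitalSubalgebra ℂ A |
      SpectralExt.IsClosedIdeal I ∧ SpectralExt.HasSEP I}, (I : Set A))
  have hSEP := SpectralExt.hasSEP_closedIdealSpan
    {I : NonUnitalSubalgebra ℂ A | SpectralExt.IsClosedIdeal I ∧ SpectralExt.HasSEP I}
    fun _ hI => hI
  refine ⟨_, ⟨⟨hJ, hSEP⟩, fun I hI => ?_⟩, rfl, fun hA => ?_⟩
  · exact (Set.subset_biUnion_of_mem
      (u := fun I : NonUnitalSubalgebra ℂ A => (I : Set A)) hI).trans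
      (SpectralExt.subset_closedIdealSpan _)
  · have := hJ.completeSpace
    have hpos := SpectralExt.specRadius_pos_of_isSemisimpleAlg hA hJ
    exact ⟨hSEP.hasUUNP hpos, hSEP.hasPropertyP hpos⟩
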